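/- Let $n,p$ be non-negative integers. For $D\in\mathbb R^{n\times p}$ (the standardised data) and symmetric positive definite $\Sigma_R\in\mathbb R^{n\times n}$, $\Sigma_C\in\mathbb R^{p\times p}$ consider the zero-mean matrix-normal likelihood, with exponents taken as $$\ell(\Sigma_R,\Sigma_C\mid D)=\frac{1}{(2\pi)^{np/2}\,|\Sigma_C|^{p/2}\,|\Sigma_R|^{n/2}}\exp\Big[-\tfrac12\operatorname{tr}\big\{\Sigma_R^{-1}D\,\Sigma_C^{-1}D^{T}\big\}\Big],$$ and the improper prior density $\pi_0(\Sigma_R)=|\Sigma_R|^{-n/2-1}$ with respect to $d\Sigma_R=\prod_{i\le j}d(\Sigma_R)_{ij}$ on all positive definite $n\times n$ matrices. All integrals below are of non-negative functions with values in $[0,\infty]$, with $1/0=\infty$. Put $$m(D\mid\Sigma_C)=\int \ell(\Sigma_R,\Sigma_C\mid D)\,\pi_0(\Sigma_R)\,d\Sigma_R .$$ There is a constant $K\in(0,\infty)$, depending only on $n$ and $p$, such that the following holds. (1) For every $D$ and every positive definite $\Sigma_C$, $$m(D\mid\Sigma_C)=\frac{K}{|\Sigma_C|^{p/2}\,|D\Sigma_C^{-1}D^{T}|^{(n+1)/2}},$$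 and this is finite if and only if $D$ has rank $n$. (2) Let $\nu\neq0$ be a $\sigma$-finite reference measure on $\mathbb R^{n\times p}$, with respect to which densities of the data are taken, such that $c(\Sigma_C):=\int m(D'\mid\Sigma_C)\,d\nu(D')$ is finite for every positive definite $\Sigma_C$, so that the likelihood can be normalised. Then, for every positive definite $\Sigma_C$, $c(\Sigma_C)>0$; the likelihood of $\Sigma_C$, $\ell(\Sigma_C\mid D)\equiv f(D\mid\Sigma_C):=m(D\mid\Sigma_C)/c(\Sigma_C)$, is a probability density in $D$ with respect to $\nu$; and for every $D$ $$\ell(\Sigma_C\mid D)=\frac{K}{c(\Sigma_C)\,|\Sigma_C|^{p/2}\,|D\Sigma_C^{-1}D^{T}|^{(n+1)/2}} .$$ Moreover, let the prior on $\Sigma_C$ be uniform on the positive definite $p\times p$ correlation matrices, i.e. have constant density $u=1/\mathrm{vol}$ with respect to Lebesgue measure in the entries above the diagonal, where $\mathrm{vol}$ is the volume of this set. Then the joint kernel $\frac{\ell(\Sigma_R,\Sigma_C\mid D)}{c(\Sigma_C)}\,\pi_0(\Sigma_R)\,u$ has integral $u\,\ell(\Sigma_C\mid D)$ over $\Sigma_R$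 (also for positive definite $\Sigma_C$ that are not correlation matrices). (3) In the situation of (2), let $D$ be such that the total mass of the joint kernel over $(\Sigma_R,\Sigma_C)$ is finite, and let the joint posterior density be the joint kernel divided by its total mass. Then its marginal $\pi(\Sigma_C\mid D)=\int\pi(\Sigma_R,\Sigma_C\mid D)\,d\Sigma_R$ is a probability density on the correlation matrices, and, as functions of the positive definite correlation matrix $\Sigma_C$ (with constants of proportionality in $(0,\infty)$ that do not depend on $\Sigma_C$), $$\pi(\Sigma_C\mid D)\ \propto\ \frac{1}{c(\Sigma_C)\,|\Sigma_C|^{p/2}\,|D\Sigma_C^{-1}D^{T}|^{(n+1)/2}},\qquad \ell(\Sigma_C\mid D)\ \propto\ \pi(\Sigma_C\mid D).$$ -/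

import Mathlib

open MeasureTheory
open scoped ENNReal Matrix

noncomputable section

/-- Index set of the entries on and above the diagonal of a `d × d` matrix. -/
abbrev UpperIndex (d : ℕ) : Type := {ij : Fin d × Fin d // ij.1 ≤ ij.2}

/-- Index set of the entries strictly above the diagonal of a `d × d` matrix. -/
abbrev StrictUpperIndex (d : ℕ) : Type := {ij : Fin d × Fin d // ij.1 < ij.2}

/-- The symmetric matrix with the given entries on and above the diagonal. -/
def symMatrix {d : ℕ} (s : UpperIndex d → ℝ) : Matrix (Fin d) (Fin d) ℝ :=
  Matrix.of fun i j => s ⟨(min i j, max i j), min_le_max⟩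

/-- The symmetric matrix with unit diagonal and the given entries above the diagonal. -/
def corrMatrix {d : ℕ} (r : StrictUpperIndex d → ℝ) : Matrix (Fin d) (Fin d) ℝ :=
  Matrix.of fun i j =>
    if h : i < j then r ⟨(i, j), h⟩ else if h' : j < i then r ⟨(j, i), h'⟩ else 1

/-- The integral `∫ F(Σ) dΣ` over all positive definite `d × d` covariance matrices, with
`dΣ = ∏_{i ≤ j} dΣ_{ij}` the Lebesgue measure in the entries on and above the diagonal. -/
def covIntegral {d : ℕ} (F : Matrix (Fin d) (Fin d) ℝ → ℝ≥0∞) : ℝ≥0∞ :=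
  ∫⁻ s in {s : UpperIndex d → ℝ | (symMatrix s).PosDef}, F (symMatrix s)

/-- The off-diagonal coordinates of the positive definite (i.e. invertible) correlation
matrices. -/
def corrRegion (d : ℕ) : Set (StrictUpperIndex d → ℝ) := {r | (corrMatrix r).PosDef}

/-- The integral `∫ F(Σ) dΣ` over all positive definite `d × d` correlation matrices, with
`dΣ = ∏_{i < j} dΣ_{ij}` the Lebesgue measure in the entries above the diagonal. -/
def corrIntegral {d : ℕ} (F : Matrix (Fin d) (Fin d) ℝ → ℝ≥0∞) : ℝ≥0∞ :=
  ∫⁻ r in corrRegion d, F (corrMatrix r)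

section Model

variable {n p : ℕ}

/-- The zero-mean matrix-normal likelihood `ℓ(Σ_R, Σ_C | D)` of the inter-row covariance
`R = Σ_R` and the inter-column covariance `C = Σ_C`, with the exponents `p / 2` of `|Σ_C|` and
`n / 2` of `|Σ_R|`. -/
def matrixNormalLikelihood (R : Matrix (Fin n) (Fin n) ℝ) (C : Matrix (Fin p) (Fin p) ℝ)
    (D : Matrix (Fin n) (Fin p) ℝ) : ℝ :=
  1 / ((2 * Real.pi) ^ ((n : ℝ) * (p : ℝ) / 2) * C.det ^ ((p : ℝ) / 2) * R.det ^ ((n : ℝ) / 2)) *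
    Real.exp (-(1 / 2) * (R⁻¹ * D * C⁻¹ * Dᵀ).trace)

/-- The improper prior density `|Σ_R| ^ (-n/2 - 1)` on the inter-row covariance. -/
def rowPrior (R : Matrix (Fin n) (Fin n) ℝ) : ℝ := R.det ^ (-(n : ℝ) / 2 - 1)

/-- The uniform prior density on the positive definite `p × p` correlation matrices, relative to
Lebesgue measure in the entries above the diagonal. -/
def uniformPrior (p : ℕ) : ℝ≥0∞ := (volume (corrRegion p))⁻¹

/-- The likelihood with `Σ_R` integrated out against its prior, before normalisation in `D`. -/
def unnormalisedLikelihood (C : Matrix (Fin p) (Fin p) ℝ) (D : Matrix (Fin n) (Fin p) ℝ) : ℝ≥0∞ :=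
  covIntegral fun R : Matrix (Fin n) (Fin n) ℝ =>
    ENNReal.ofReal (matrixNormalLikelihood R C D * rowPrior R)

/-- The data matrix with the given entries. -/
def dataMatrix (x : Fin n → Fin p → ℝ) : Matrix (Fin n) (Fin p) ℝ := Matrix.of x

/-- `c(Σ_C)`: the total mass of the likelihood of `Σ_C` over all data sets. Here `ν` is the
reference measure on the space of data sets with respect to which probability densities of the
data are taken. -/
def normaliser (ν : Measure (Fin n → Fin p → ℝ)) (C : Matrix (Fin p) (Fin p) ℝ) : ℝ≥0∞ :=
  ∫⁻ x, unnormalisedLikelihood C (dataMatrix x) ∂ν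

/-- The likelihood `ℓ(Σ_C | D) = f(D | Σ_C)`: the probability density (relative to `ν`) of the data
given `Σ_C`. -/
def likelihood (ν : Measure (Fin n → Fin p → ℝ)) (C : Matrix (Fin p) (Fin p) ℝ)
    (D : Matrix (Fin n) (Fin p) ℝ) : ℝ≥0∞ :=
  unnormalisedLikelihood C D / normaliser ν C

/-- Normalised likelihood of `(Σ_R, Σ_C)` times the two priors: the joint posterior density of
`(Σ_R, Σ_C)` up to a factor that depends only on the data. -/
def jointKernel (ν : Measure (Fin n → Fin p → ℝ)) (D : Matrix (Fin n) (Fin p) ℝ)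
    (R : Matrix (Fin n) (Fin n) ℝ) (C : Matrix (Fin p) (Fin p) ℝ) : ℝ≥0∞ :=
  ENNReal.ofReal (matrixNormalLikelihood R C D) / normaliser ν C *
    ENNReal.ofReal (rowPrior R) * uniformPrior p

/-- The total mass of the joint kernel over all correlation matrices `Σ_C` and all
covariance matrices `Σ_R`. -/
def evidence (ν : Measure (Fin n → Fin p → ℝ)) (D : Matrix (Fin n) (Fin p) ℝ) : ℝ≥0∞ :=
  corrIntegral fun C : Matrix (Fin p) (Fin p) ℝ => covIntegral fun R => jointKernel ν D R C

/-- The joint posterior density of `(Σ_R, Σ_C)` given the data, by Bayes' rule. -/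
def jointPosterior (ν : Measure (Fin n → Fin p → ℝ)) (D : Matrix (Fin n) (Fin p) ℝ)
    (R : Matrix (Fin n) (Fin n) ℝ) (C : Matrix (Fin p) (Fin p) ℝ) : ℝ≥0∞ :=
  jointKernel ν D R C / evidence ν D

/-- The posterior density `π(Σ_C | D)`: the joint posterior density marginalised over `Σ_R`. -/
def posterior (ν : Measure (Fin n → Fin p → ℝ)) (D : Matrix (Fin n) (Fin p) ℝ)
    (C : Matrix (Fin p) (Fin p) ℝ) : ℝ≥0∞ :=
  covIntegral fun R => jointPosterior ν D R C

/-- `|Σ_C| ^ (p/2) * |D Σ_C⁻¹ Dᵀ| ^ ((n+1)/2)`. -/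
def detFactor (D : Matrix (Fin n) (Fin p) ℝ) (C : Matrix (Fin p) (Fin p) ℝ) : ℝ≥0∞ :=
  ENNReal.ofReal (C.det ^ ((p : ℝ) / 2) * (D * C⁻¹ * Dᵀ).det ^ (((n : ℝ) + 1) / 2))

end Model

end

/-! The powers of `|Σ_R|` in likelihood and prior combine to `|Σ_R|^{-(n+1)}`, exactly the Jacobian
of `X ↦ X⁻¹` on symmetric matrices. Substituting `X = Σ_R⁻¹` (`covIntegral_inv`) turns the integral
into a Laplace transform over the positive definite cone, evaluated at `S = D Σ_C⁻¹ Dᵀ`. If `S = Bᵀ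
B` is positive definite, the change of variables `X ↦ B X Bᵀ` (`covIntegral_congruence`) scales the
transform at `1` by `|det B|^{-(n+1)} = |S|^{-(n+1)/2}`. If `S` is singular, comparison with `S + ε
• 1` shows that both sides are infinite (`coneLaplace_posSemidef`). Both Jacobians rest on
`det_congruence`, and `K` is finite and positive because the transform at `1` is.

The rest is Bayes' rule in `[0, ∞]`. A vanishing `c(Σ_C)` would force `ν = 0`, since the integrand
is nowhere zero. The evidence is positive because a measurable positive function is integrated over
a set of positive volume. Posterior and likelihood then differ by a factor independent of `Σ_C`. -/

/-! ### Symmetric coordinates and the determinant of a congruence -/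

/-- The entries of a matrix on and above the diagonal. -/
def upperEntries (d : ℕ) : Matrix (Fin d) (Fin d) ℝ →ₗ[ℝ] (UpperIndex d → ℝ) where
  toFun M ij := M ij.1.1 ij.1.2
  map_add' _ _ := rfl
  map_smul' _ _ := rfl

/-- `symMatrix` as a linear map. -/
def symMatrixLinear (d : ℕ) : (UpperIndex d → ℝ) →ₗ[ℝ] Matrix (Fin d) (Fin d) ℝ where
  toFun := symMatrix
  map_add' _ _ := rfl
  map_smul' _ _ := rfl

@[simp] lemma symMatrixLinear_apply {d : ℕ} (s : UpperIndex d → ℝ) :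
    symMatrixLinear d s = symMatrix s := rfl

lemma upperEntries_apply {d : ℕ} (M : Matrix (Fin d) (Fin d) ℝ) (ij : UpperIndex d) :
    upperEntries d M ij = M ij.1.1 ij.1.2 := rfl

@[simp] lemma upperEntries_symMatrix {d : ℕ} (s : UpperIndex d → ℝ) :
    upperEntries d (symMatrix s) = s := by
  funext ⟨⟨i, j⟩, h⟩
  simp [upperEntries_apply, symMatrix, min_eq_left (show i ≤ j from h),
    max_eq_right (show i ≤ j from h)]

lemma transpose_symMatrix {d : ℕ} (s : UpperIndex d → ℝ) : (symMatrix s)ᵀ = symMatrix s := by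
  ext i j
  simp [symMatrix, min_comm, max_comm]

lemma symMatrix_upperEntries {d : ℕ} {M : Matrix (Fin d) (Fin d) ℝ} (hM : Mᵀ = M) :
    symMatrix (upperEntries d M) = M := by
  ext i j
  simp only [upperEntries_apply, symMatrix, Matrix.of_apply]
  rcases le_total i j with h | h
  · simp [min_eq_left h, max_eq_right h]
  · simp only [min_eq_right h, max_eq_left h]
    exact congrFun (congrFun hM i) j

/-- The congruence `X ↦ A X Aᵀ` on symmetric matrices, in the coordinates on and above the
diagonal. -/
def congruence {d : ℕ} (A : Matrix (Fin d) (Fin d) ℝ) :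
    (UpperIndex d → ℝ) →ₗ[ℝ] (UpperIndex d → ℝ) :=
  upperEntries d ∘ₗ LinearMap.mulLeftRight ℝ (A, Aᵀ) ∘ₗ symMatrixLinear d

lemma congruence_apply {d : ℕ} (A : Matrix (Fin d) (Fin d) ℝ) (s : UpperIndex d → ℝ) :
    congruence A s = upperEntries d (A * symMatrix s * Aᵀ) := by
  simp [congruence, LinearMap.mulLeftRight_apply]

lemma symMatrix_congruence {d : ℕ} (A : Matrix (Fin d) (Fin d) ℝ) (s : UpperIndex d → ℝ) :
    symMatrix (congruence A s) = A * symMatrix s * Aᵀ := by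
  rw [congruence_apply, symMatrix_upperEntries]
  simp [Matrix.transpose_mul, transpose_symMatrix, Matrix.mul_assoc]

lemma congruence_mul {d : ℕ} (A B : Matrix (Fin d) (Fin d) ℝ) :
    congruence (A * B) = congruence A * congruence B := by
  ext1 s
  ext1
  simp only [LinearMap.comp_apply, Module.End.mul_apply]
  rw [congruence_apply, congruence_apply A, symMatrix_congruence]
  simp [Matrix.transpose_mul, Matrix.mul_assoc]

lemma congruence_one {d : ℕ} : congruence (1 : Matrix (Fin d) (Fin d) ℝ) = 1 := by
  apply LinearMap.ext
  intro s
  simp [congruence_apply]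

/-- With indices from `0`, `i` is the first entry of `d - i` pairs and the second entry of `i + 1`
pairs, so `a i` occurs `d + 1` times. -/
lemma prod_upperIndex {d : ℕ} (a : Fin d → ℝ) :
    ∏ ij : UpperIndex d, a ij.1.1 * a ij.1.2 = (∏ i, a i) ^ (d + 1) := by
  have key : ∀ g : Fin d × Fin d → ℝ, ∏ ij : UpperIndex d, g ij.1 =
      ∏ i, ∏ j, if i ≤ j then g (i, j) else 1 := by
    intro g
    rw [← Fintype.prod_prod_type (f := fun x : Fin d × Fin d => if x.1 ≤ x.2 then g x else 1),
      ← Finset.prod_filter]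
    exact (Finset.prod_subtype _ (by simp) g).symm
  rw [Finset.prod_mul_distrib, key fun x => a x.1, key fun x => a x.2,
    Finset.prod_comm (f := fun i j => if i ≤ j then a (i, j).2 else 1), ← Finset.prod_mul_distrib,
    ← Finset.prod_pow]
  refine Finset.prod_congr rfl fun i _ => ?_
  rw [← Finset.prod_filter, ← Finset.prod_filter]
  dsimp only
  rw [Finset.prod_const, Finset.prod_const, ← pow_add]
  congr 1
  have h1 : (Finset.univ.filter fun j : Fin d => i ≤ j) = Finset.Ici i := by ext; simp
  have h2 : (Finset.univ.filter fun j : Fin d => j ≤ i) = Finset.Iic i := by ext; simp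
  rw [h1, h2, Fin.card_Ici, Fin.card_Iic]
  omega

lemma det_congruence_diagonal {d : ℕ} (a : Fin d → ℝ) :
    LinearMap.det (congruence (Matrix.diagonal a)) = (Matrix.diagonal a).det ^ (d + 1) := by
  have : congruence (Matrix.diagonal a) =
      Matrix.toLin' (Matrix.diagonal fun ij : UpperIndex d => a ij.1.1 * a ij.1.2) := by
    apply LinearMap.ext
    intro s
    funext ij
    rw [congruence_apply, Matrix.toLin'_apply, Matrix.mulVec_diagonal]
    simp only [upperEntries_apply, Matrix.diagonal_transpose, Matrix.mul_diagonal,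
      Matrix.diagonal_mul]
    conv_rhs => rw [← upperEntries_symMatrix s]
    simp only [upperEntries_apply]
    ring
  rw [this, LinearMap.det_toLin', Matrix.det_diagonal, Matrix.det_diagonal, prod_upperIndex]

/-- Conjugation by a diagonal matrix makes a transvection equivalent to its square, so that any
multiplicative invariant of it is trivial. -/
lemma det_congruence_transvection {d : ℕ} (t : Matrix.TransvectionStruct (Fin d) ℝ) :
    LinearMap.det (congruence t.toMatrix) = 1 := by
  set φ : Matrix (Fin d) (Fin d) ℝ → ℝ := fun A => LinearMap.det (congruence A) with hφ
  have hmul : ∀ A B, φ (A * B) = φ A * φ B := fun A B => by simp [hφ, congruence_mul]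
  have h1 : φ 1 = 1 := by simp [hφ, congruence_one]
  obtain ⟨i, j, hij, c⟩ := t
  change φ (Matrix.transvection i j c) = 1
  -- The entry `2` at position `i` doubles `c` under conjugation, and doubling `c` squares the
  -- transvection. Hence `φ` of it is a nonzero idempotent.
  set a : Fin d → ℝ := Function.update 1 i 2 with ha
  have hai : a i = 2 := by simp [ha]
  have haj : a j = 1 := by simp [ha, hij.symm]
  have hconj : Matrix.diagonal a * Matrix.transvection i j c =
      Matrix.transvection i j c * Matrix.transvection i j c * Matrix.diagonal a := by
    rw [Matrix.transvection_mul_transvection_same _ _ hij]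
    ext k l
    rw [Matrix.diagonal_mul, Matrix.mul_diagonal, Matrix.transvection, Matrix.transvection,
      Matrix.add_apply, Matrix.add_apply, mul_add, add_mul]
    congr 1
    · by_cases hkl : k = l
      · subst hkl; simp
      · simp [Matrix.one_apply_ne hkl]
    · rw [Matrix.single_apply, Matrix.single_apply]
      split_ifs with h
      · rw [← h.1, ← h.2, hai, haj]; ring
      · simp
  have hne : φ (Matrix.transvection i j c) ≠ 0 := by
    intro h0
    have : φ (Matrix.transvection i j c * Matrix.transvection i j (-c)) = 0 := by
      rw [hmul, h0, zero_mul]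
    rw [Matrix.transvection_mul_transvection_same _ _ hij, add_neg_cancel,
      Matrix.transvection_zero, h1] at this
    exact one_ne_zero this
  have hdiag : φ (Matrix.diagonal a) ≠ 0 := by
    rw [hφ]
    simp only [det_congruence_diagonal, Matrix.det_diagonal]
    refine pow_ne_zero _ (Finset.prod_ne_zero_iff.2 fun k _ => ?_)
    by_cases hk : k = i
    · rw [hk, hai]; norm_num
    · simp [ha, hk]
  have := congrArg φ hconj
  rw [hmul, hmul, hmul, mul_comm] at this
  have h2 := mul_right_cancel₀ hdiag this
  exact (mul_left_cancel₀ hne (by rw [mul_one]; exact h2)).symm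

/-- Both sides are multiplicative in `A`, and every matrix is a product of diagonal matrices and
transvections. -/
theorem det_congruence {d : ℕ} (A : Matrix (Fin d) (Fin d) ℝ) :
    LinearMap.det (congruence A) = A.det ^ (d + 1) := by
  refine Matrix.diagonal_transvection_induction
    (fun A => LinearMap.det (congruence A) = A.det ^ (d + 1)) A
    (fun a _ => det_congruence_diagonal a) (fun t => ?_) fun A B hA hB => ?_
  · simp [det_congruence_transvection]
  · simp [congruence_mul, hA, hB, mul_pow]

/-! ### Topology and volume of the positive definite regions -/

lemma continuous_symMatrix {d : ℕ} :
    Continuous (symMatrix : (UpperIndex d → ℝ) → Matrix (Fin d) (Fin d) ℝ) :=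
  continuous_matrix fun _ _ => continuous_apply _

lemma continuous_corrMatrix {d : ℕ} :
    Continuous (corrMatrix : (StrictUpperIndex d → ℝ) → Matrix (Fin d) (Fin d) ℝ) := by
  refine continuous_matrix fun i j => ?_
  simp only [corrMatrix, Matrix.of_apply]
  split_ifs
  · exact continuous_apply _
  · exact continuous_apply _
  · exact continuous_const

lemma transpose_corrMatrix {d : ℕ} (r : StrictUpperIndex d → ℝ) :
    (corrMatrix r)ᵀ = corrMatrix r := by
  ext i j
  rcases lt_trichotomy i j with h | h | h
  · simp [corrMatrix, h, h.not_gt]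
  · simp [corrMatrix, h]
  · simp [corrMatrix, h, h.not_gt]

lemma posDef_iff_forall_sphere {d : ℕ} {M : Matrix (Fin d) (Fin d) ℝ} (hM : Mᵀ = M) :
    M.PosDef ↔ ∀ x ∈ Metric.sphere (0 : Fin d → ℝ) 1, 0 < x ⬝ᵥ (M *ᵥ x) := by
  have hH : M.IsHermitian := by
    rw [Matrix.IsHermitian, Matrix.conjTranspose_eq_transpose_of_trivial, hM]
  constructor
  · intro h x hx
    have hx0 : x ≠ 0 := by
      rintro rfl
      simp at hx
    simpa using h.dotProduct_mulVec_pos hx0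
  · intro h
    refine Matrix.PosDef.of_dotProduct_mulVec_pos hH fun x hx => ?_
    have hn : 0 < ‖x‖ := norm_pos_iff.2 hx
    have := h (‖x‖⁻¹ • x) (by simp [norm_smul, hn.ne'])
    rw [Matrix.mulVec_smul, dotProduct_smul, smul_dotProduct, smul_eq_mul, smul_eq_mul,
      ← mul_assoc] at this
    simpa using (pos_iff_pos_of_mul_pos this).1 (by positivity)

/-- Positivity of the quadratic form need only be tested on the unit sphere, whose compactness makes
the condition stable under small changes of `t`. -/
lemma isOpen_setOf_posDef {d : ℕ} {T : Type*} [TopologicalSpace T]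
    {f : T → Matrix (Fin d) (Fin d) ℝ} (hf : Continuous f) (hsymm : ∀ t, (f t)ᵀ = f t) :
    IsOpen {t | (f t).PosDef} := by
  simp only [posDef_iff_forall_sphere (hsymm _)]
  rw [isOpen_iff_mem_nhds]
  intro t ht
  refine (isCompact_sphere (0 : Fin d → ℝ) 1).eventually_forall_of_forall_eventually
    fun x hx => ?_
  have hc : Continuous fun z : T × (Fin d → ℝ) => z.2 ⬝ᵥ (f z.1 *ᵥ z.2) :=
    continuous_snd.dotProduct ((hf.comp continuous_fst).matrix_mulVec continuous_snd)
  exact hc.continuousAt.eventually (lt_mem_nhds (ht x hx))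

/-- The coordinates of the positive definite matrices. -/
def posDefRegion (d : ℕ) : Set (UpperIndex d → ℝ) := {s | (symMatrix s).PosDef}

lemma isOpen_posDefRegion (d : ℕ) : IsOpen (posDefRegion d) :=
  isOpen_setOf_posDef continuous_symMatrix transpose_symMatrix

lemma isOpen_corrRegion (d : ℕ) : IsOpen (corrRegion d) :=
  isOpen_setOf_posDef continuous_corrMatrix transpose_corrMatrix

lemma volume_posDefRegion_ne_zero (d : ℕ) : volume (posDefRegion d) ≠ 0 := by
  refine ((isOpen_posDefRegion d).measure_pos volume ⟨upperEntries d 1, ?_⟩).ne'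
  rw [posDefRegion, Set.mem_ofPred_eq, symMatrix_upperEntries Matrix.transpose_one]
  exact Matrix.PosDef.one

lemma volume_corrRegion_ne_zero (d : ℕ) : volume (corrRegion d) ≠ 0 := by
  refine ((isOpen_corrRegion d).measure_pos volume ⟨0, ?_⟩).ne'
  have : corrMatrix (0 : StrictUpperIndex d → ℝ) = 1 := by
    ext i j
    rcases lt_trichotomy i j with h | h | h
    · simp [corrMatrix, h, h.ne]
    · subst h; simp [corrMatrix]
    · simp [corrMatrix, h, h.ne', h.not_gt]
  rw [corrRegion, Set.mem_ofPred_eq, this]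
  exact Matrix.PosDef.one

/-- Evaluate the quadratic form at `e_i + e_j` and `e_i - e_j`. The bound makes the correlation
region bounded and controls every entry by the trace. -/
lemma abs_apply_le_half_add {d : ℕ} {M : Matrix (Fin d) (Fin d) ℝ} (hM : M.PosSemidef)
    (i j : Fin d) : |M i j| ≤ (M i i + M j j) / 2 := by
  have key : ∀ e : ℝ, e ^ 2 = 1 → 0 ≤ M i i + 2 * e * M i j + M j j := by
    intro e he
    have h := hM.dotProduct_mulVec_nonneg (Pi.single i 1 + e • Pi.single j 1)
    have hs : M j i = M i j := by simpa using hM.1.apply i j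
    simp [Matrix.mulVec_add, Matrix.mulVec_smul, add_dotProduct, dotProduct_add,
      smul_dotProduct, dotProduct_smul, single_dotProduct, hs] at h
    have h2 : e * (e * M j j) = M j j := by rw [← mul_assoc, ← sq, he, one_mul]
    linarith
  rw [abs_le]
  constructor <;> linarith [key 1 (by norm_num), key (-1) (by norm_num)]

lemma volume_corrRegion_ne_top (d : ℕ) : volume (corrRegion d) ≠ ⊤ := by
  have hsub : corrRegion d ⊆ Metric.closedBall 0 1 := by
    intro r hr
    rw [mem_closedBall_zero_iff, pi_norm_le_iff_of_nonneg zero_le_one]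
    rintro ⟨⟨i, j⟩, h⟩
    have := abs_apply_le_half_add (Matrix.PosDef.posSemidef hr) i j
    simpa [corrMatrix, show i < j from h] using this
  exact ((measure_mono hsub).trans_lt measure_closedBall_lt_top).ne

/-! ### Changes of variables on the cone -/

lemma covIntegral_eq {d : ℕ} (F : Matrix (Fin d) (Fin d) ℝ → ℝ≥0∞) :
    covIntegral F = ∫⁻ s in posDefRegion d, F (symMatrix s) := rfl

lemma covIntegral_congr {d : ℕ} {F G : Matrix (Fin d) (Fin d) ℝ → ℝ≥0∞}
    (h : ∀ R, R.PosDef → F R = G R) : covIntegral F = covIntegral G :=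
  setLIntegral_congr_fun (isOpen_posDefRegion d).measurableSet fun s hs => h (symMatrix s) hs

lemma covIntegral_mono {d : ℕ} {F G : Matrix (Fin d) (Fin d) ℝ → ℝ≥0∞}
    (h : ∀ R, R.PosDef → F R ≤ G R) : covIntegral F ≤ covIntegral G :=
  setLIntegral_mono' (isOpen_posDefRegion d).measurableSet fun s hs => h (symMatrix s) hs

lemma covIntegral_const_mul {d : ℕ} {c : ℝ≥0∞} (hc : c ≠ ⊤)
    (F : Matrix (Fin d) (Fin d) ℝ → ℝ≥0∞) :
    covIntegral (fun R => c * F R) = c * covIntegral F :=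
  lintegral_const_mul' c _ hc

lemma posDef_congruence_iff {d : ℕ} {B : Matrix (Fin d) (Fin d) ℝ} (hB : B.det ≠ 0)
    (M : Matrix (Fin d) (Fin d) ℝ) : (B * M * Bᵀ).PosDef ↔ M.PosDef := by
  have hU : IsUnit B := (Matrix.isUnit_iff_isUnit_det B).2 hB.isUnit
  simpa [Matrix.star_eq_conjTranspose, Matrix.conjTranspose_eq_transpose_of_trivial] using
    Matrix.IsUnit.posDef_star_right_conjugate_iff (x := M) hU

/-- Change of variables `X ↦ B X Bᵀ` in an integral over positive definite matrices. -/
lemma covIntegral_congruence {d : ℕ} {B : Matrix (Fin d) (Fin d) ℝ} (hB : B.det ≠ 0)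
    (F : Matrix (Fin d) (Fin d) ℝ → ℝ≥0∞) :
    covIntegral F = ENNReal.ofReal (|B.det| ^ (d + 1)) * covIntegral fun X => F (B * X * Bᵀ) := by
  have hBi : B⁻¹.det ≠ 0 := by
    rw [Matrix.det_nonsing_inv, Ring.inverse_eq_inv']; exact inv_ne_zero hB
  have hinv : ∀ A A' : Matrix (Fin d) (Fin d) ℝ, A * A' = 1 →
      ∀ s, congruence A (congruence A' s) = s := by
    intro A A' h s
    rw [← Module.End.mul_apply, ← congruence_mul, h, congruence_one, Module.End.one_apply]
  have himg : congruence B '' posDefRegion d = posDefRegion d := by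
    ext s
    constructor
    · rintro ⟨s, hs, rfl⟩
      rw [posDefRegion, Set.mem_ofPred_eq, symMatrix_congruence]
      exact (posDef_congruence_iff hB _).2 hs
    · intro hs
      refine ⟨congruence B⁻¹ s, ?_, hinv _ _ (Matrix.mul_nonsing_inv _ hB.isUnit) s⟩
      rw [posDefRegion, Set.mem_ofPred_eq, symMatrix_congruence]
      exact (posDef_congruence_iff hBi _).2 hs
  have hinj : Set.InjOn (congruence B) (posDefRegion d) :=
    (Function.LeftInverse.injective
      (hinv _ _ (Matrix.nonsing_inv_mul _ hB.isUnit))).injOn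
  have h := lintegral_image_eq_lintegral_abs_det_fderiv_mul volume
    (isOpen_posDefRegion d).measurableSet
    (fun s _ => (LinearMap.toContinuousLinearMap (congruence B)).hasFDerivWithinAt) hinj
    (fun s => F (symMatrix s))
  rw [LinearMap.coe_toContinuousLinearMap', himg] at h
  rw [covIntegral_eq, h, ← covIntegral_const_mul ENNReal.ofReal_ne_top]
  refine lintegral_congr fun s => ?_
  rw [LinearMap.det_toContinuousLinearMap, det_congruence, abs_pow, symMatrix_congruence]

section Inversion

attribute [local instance] Matrix.linftyOpNormedRing Matrix.linftyOpNormedAlgebra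

/-- Inversion at `S` has derivative `T ↦ -S⁻¹ T S⁻¹`, which is minus a congruence because `S⁻¹` is
symmetric; `det_congruence` thus also gives this Jacobian. -/
lemma hasFDerivAt_upperEntries_inv {d : ℕ} {s : UpperIndex d → ℝ} (hs : (symMatrix s).PosDef) :
    HasFDerivAt (fun s => upperEntries d (symMatrix s)⁻¹)
      (LinearMap.toContinuousLinearMap (-congruence (symMatrix s)⁻¹)) s := by
  have hu := hs.isUnit
  have h1 := hasFDerivAt_ringInverse (𝕜 := ℝ) hu.unit
  rw [hu.unit_spec] at h1
  have h2 : HasFDerivAt (symMatrix : (UpperIndex d → ℝ) → Matrix (Fin d) (Fin d) ℝ)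
      (LinearMap.toContinuousLinearMap (symMatrixLinear d)) s :=
    (LinearMap.toContinuousLinearMap (symMatrixLinear d)).hasFDerivAt
  have h3 := ((LinearMap.toContinuousLinearMap (upperEntries d)).hasFDerivAt).comp s
    (h1.comp s h2)
  refine (h3.congr_fderiv ?_).congr_of_eventuallyEq (Filter.Eventually.of_forall fun t => ?_)
  · ext1 t
    have hi : ((hu.unit⁻¹ : (Matrix (Fin d) (Fin d) ℝ)ˣ) : Matrix (Fin d) (Fin d) ℝ) =
        (symMatrix s)⁻¹ := by
      rw [Matrix.coe_units_inv, hu.unit_spec]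
    rw [hi]
    change upperEntries d (-(ContinuousLinearMap.mulLeftRight ℝ (Matrix (Fin d) (Fin d) ℝ)
      (symMatrix s)⁻¹ (symMatrix s)⁻¹ (symMatrix t))) = -congruence (symMatrix s)⁻¹ t
    rw [ContinuousLinearMap.mulLeftRight_apply, map_neg, congruence_apply,
      Matrix.transpose_nonsing_inv, transpose_symMatrix]
  · simp [Matrix.nonsing_inv_eq_ringInverse]

/-- Change of variables `X ↦ X⁻¹` in an integral over positive definite matrices. -/
lemma covIntegral_inv {d : ℕ} (F : Matrix (Fin d) (Fin d) ℝ → ℝ≥0∞) :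
    covIntegral F = covIntegral fun R => ENNReal.ofReal (R.det⁻¹ ^ (d + 1)) * F R⁻¹ := by
  set f : (UpperIndex d → ℝ) → (UpperIndex d → ℝ) := fun s => upperEntries d (symMatrix s)⁻¹
    with hf
  have hfs : ∀ s, symMatrix (f s) = (symMatrix s)⁻¹ := fun s =>
    symMatrix_upperEntries (by rw [Matrix.transpose_nonsing_inv, transpose_symMatrix])
  have hmaps : ∀ s ∈ posDefRegion d, f s ∈ posDefRegion d := by
    intro s hs
    rw [posDefRegion, Set.mem_ofPred_eq, hfs]
    exact Matrix.PosDef.inv hs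
  have hinv : ∀ s ∈ posDefRegion d, f (f s) = s := by
    intro s hs
    change upperEntries d (symMatrix (f s))⁻¹ = s
    rw [hfs, Matrix.nonsing_inv_nonsing_inv _
      (Matrix.PosDef.det_pos hs).ne'.isUnit, upperEntries_symMatrix]
  have himg : f '' posDefRegion d = posDefRegion d := by
    ext s
    constructor
    · rintro ⟨s, hs, rfl⟩
      exact hmaps s hs
    · exact fun hs => ⟨f s, hmaps s hs, hinv s hs⟩
  have hinj : Set.InjOn f (posDefRegion d) := by
    intro s hs t ht h
    rw [← hinv s hs, h, hinv t ht]
  have h := lintegral_image_eq_lintegral_abs_det_fderiv_mul volume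
    (isOpen_posDefRegion d).measurableSet
    (fun s hs => (hasFDerivAt_upperEntries_inv hs).hasFDerivWithinAt) hinj
    (fun s => F (symMatrix s))
  rw [himg] at h
  rw [covIntegral_eq, h, covIntegral_eq]
  refine setLIntegral_congr_fun (isOpen_posDefRegion d).measurableSet fun s hs => ?_
  -- The minus sign contributes a power of `-1`, which the absolute value removes.
  rw [hfs, LinearMap.det_toContinuousLinearMap, ← neg_one_smul ℝ, LinearMap.det_smul,
    det_congruence, abs_mul, abs_pow, abs_neg, abs_one, one_pow, one_mul, abs_pow,
    Matrix.det_nonsing_inv, Ring.inverse_eq_inv',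
    abs_of_pos (inv_pos.2 (Matrix.PosDef.det_pos hs))]

end Inversion

/-! ### Laplace transform of the cone -/

/-- The Laplace transform of the cone of positive definite matrices. -/
noncomputable def coneLaplace {d : ℕ} (S : Matrix (Fin d) (Fin d) ℝ) : ℝ≥0∞ :=
  covIntegral fun X : Matrix (Fin d) (Fin d) ℝ =>
    ENNReal.ofReal (Real.exp (-(1 / 2) * (X * S).trace))

lemma measurable_exp_trace {d : ℕ} (S : Matrix (Fin d) (Fin d) ℝ) :
    Measurable fun s : UpperIndex d → ℝ =>
      ENNReal.ofReal (Real.exp (-(1 / 2) * (symMatrix s * S).trace)) := by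
  have : Continuous fun s : UpperIndex d → ℝ =>
      Real.exp (-(1 / 2) * (symMatrix s * S).trace) :=
    Real.continuous_exp.comp (continuous_const.mul
      (continuous_symMatrix.matrix_mul continuous_const).matrix_trace)
  exact this.measurable.ennreal_ofReal

lemma coneLaplace_ne_zero {d : ℕ} (S : Matrix (Fin d) (Fin d) ℝ) : coneLaplace S ≠ 0 := by
  rw [coneLaplace, covIntegral_eq, ← pos_iff_ne_zero,
    setLIntegral_pos_iff (measurable_exp_trace S)]
  have : (Function.support fun s : UpperIndex d → ℝ =>
      ENNReal.ofReal (Real.exp (-(1 / 2) * (symMatrix s * S).trace))) = Set.univ := by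
    ext s
    simp [Real.exp_pos]
  rw [this, Set.univ_inter]
  exact pos_iff_ne_zero.2 (volume_posDefRegion_ne_zero d)

lemma integrable_exp_neg_mul_abs {c : ℝ} (hc : 0 < c) :
    Integrable fun x : ℝ => Real.exp (-(c * |x|)) := by
  rw [← integrableOn_univ, ← Set.Iic_union_Ioi (a := (0 : ℝ))]
  refine IntegrableOn.union ?_ ?_
  · refine (integrableOn_exp_mul_Iic hc 0).congr_fun (fun x hx => ?_) measurableSet_Iic
    dsimp only
    rw [abs_of_nonpos hx, mul_neg, neg_neg]
  · refine (integrableOn_exp_mul_Ioi (neg_lt_zero.2 hc) 0).congr_fun (fun x hx => ?_)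
      measurableSet_Ioi
    dsimp only
    rw [abs_of_pos hx, neg_mul]

/-- On the cone the trace dominates every coordinate, so the integrand lies below an integrable
product of one-variable exponentials. -/
lemma coneLaplace_one_ne_top (d : ℕ) : coneLaplace (1 : Matrix (Fin d) (Fin d) ℝ) ≠ ⊤ := by
  set N : ℝ := (Fintype.card (UpperIndex d) : ℝ) with hN
  -- Chosen so that `c * (N + 1) = 1 / 2`; using `N + 1` instead of `N` keeps the denominator
  -- nonzero when `d = 0`.
  set c : ℝ := 1 / (2 * (N + 1)) with hc
  have hN0 : 0 ≤ N := Nat.cast_nonneg _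
  have hc0 : 0 < c := by positivity
  have hint : Integrable fun s : UpperIndex d → ℝ => ∏ ij, Real.exp (-(c * |s ij|)) :=
    Integrable.fintype_prod (f := fun _ x => Real.exp (-(c * |x|)))
      fun _ => integrable_exp_neg_mul_abs hc0
  refine ne_top_of_le_ne_top hint.lintegral_lt_top.ne ?_
  rw [coneLaplace, covIntegral_eq]
  refine (setLIntegral_mono' (isOpen_posDefRegion d).measurableSet fun s hs => ?_).trans
    (setLIntegral_le_lintegral _ _)
  refine ENNReal.ofReal_le_ofReal ?_
  rw [← Real.exp_sum, Real.exp_le_exp, mul_one, Finset.sum_neg_distrib, ← Finset.mul_sum]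
  have hpsd : (symMatrix s).PosSemidef := Matrix.PosDef.posSemidef hs
  have hdiag : ∀ i, symMatrix s i i ≤ (symMatrix s).trace := fun i =>
    Finset.single_le_sum (f := fun i => symMatrix s i i) (fun j _ => hpsd.diag_nonneg)
      (Finset.mem_univ i)
  have hbound : ∀ ij, |s ij| ≤ (symMatrix s).trace := by
    intro ij
    have h1 := abs_apply_le_half_add hpsd ij.1.1 ij.1.2
    rw [← upperEntries_apply (symMatrix s) ij, upperEntries_symMatrix] at h1
    linarith [hdiag ij.1.1, hdiag ij.1.2]
  have hsum : ∑ ij, |s ij| ≤ N * (symMatrix s).trace := by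
    refine (Finset.sum_le_sum fun ij _ => hbound ij).trans_eq ?_
    simp [hN]
  have h3 : c * ∑ ij, |s ij| ≤ c * ((N + 1) * (symMatrix s).trace) := by
    refine mul_le_mul_of_nonneg_left (hsum.trans ?_) hc0.le
    linarith [hpsd.trace_nonneg]
  have h4 : c * ((N + 1) * (symMatrix s).trace) = 1 / 2 * (symMatrix s).trace := by
    rw [hc]; field_simp
  linarith

/-- Write `S = Bᵀ B` and substitute `X ↦ B X Bᵀ` in the transform at `1`: the trace becomes `tr (X
S)`, and the Jacobian is `|det B|^(d+1)`. -/
lemma coneLaplace_posDef {d : ℕ} {S : Matrix (Fin d) (Fin d) ℝ} (hS : S.PosDef) :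
    coneLaplace S = coneLaplace (1 : Matrix (Fin d) (Fin d) ℝ) *
      (ENNReal.ofReal (S.det ^ (((d : ℝ) + 1) / 2)))⁻¹ := by
  obtain ⟨B, rfl⟩ : ∃ B : Matrix (Fin d) (Fin d) ℝ, S = Bᵀ * B := by
    open scoped MatrixOrder in
    obtain ⟨B, hB⟩ := CStarAlgebra.nonneg_iff_eq_star_mul_self.1
      (Matrix.nonneg_iff_posSemidef.2 hS.posSemidef)
    exact ⟨B, by rw [hB, Matrix.star_eq_conjTranspose,
      Matrix.conjTranspose_eq_transpose_of_trivial]⟩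
  have hdet : (Bᵀ * B).det = |B.det| ^ 2 := by
    rw [Matrix.det_mul, Matrix.det_transpose, sq_abs, sq]
  have hB : B.det ≠ 0 := by
    intro h
    have := hS.det_pos
    simp [hdet, h] at this
  have hpos : 0 < |B.det| ^ (d + 1) := pow_pos (abs_pos.2 hB) _
  have hpow : (Bᵀ * B).det ^ (((d : ℝ) + 1) / 2) = |B.det| ^ (d + 1) := by
    rw [hdet, ← Real.rpow_natCast, ← Real.rpow_natCast, ← Real.rpow_mul (abs_nonneg _)]
    congr 1
    push_cast
    ring
  have h1 : coneLaplace (1 : Matrix (Fin d) (Fin d) ℝ) =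
      ENNReal.ofReal (|B.det| ^ (d + 1)) * coneLaplace (Bᵀ * B) := by
    rw [coneLaplace, covIntegral_congruence hB, coneLaplace]
    congr 2
    funext X
    rw [mul_one, Matrix.trace_mul_comm, ← Matrix.mul_assoc, Matrix.trace_mul_comm]
  rw [h1, hpow, mul_comm, ← mul_assoc, ENNReal.inv_mul_cancel
    (ENNReal.ofReal_pos.2 hpos).ne' ENNReal.ofReal_ne_top, one_mul]

/-- For singular `S` the right side is `⊤`. The transform at `S` is at least that at the positive
definite `S + ε • 1`, which tends to `⊤` as `ε` decreases to `0`. -/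
theorem coneLaplace_posSemidef {d : ℕ} {S : Matrix (Fin d) (Fin d) ℝ} (hS : S.PosSemidef) :
    coneLaplace S = coneLaplace (1 : Matrix (Fin d) (Fin d) ℝ) *
      (ENNReal.ofReal (S.det ^ (((d : ℝ) + 1) / 2)))⁻¹ := by
  by_cases hdet : S.det = 0
  · have hexp : (0 : ℝ) < ((d : ℝ) + 1) / 2 := by positivity
    rw [hdet, Real.zero_rpow hexp.ne', ENNReal.ofReal_zero, ENNReal.inv_zero,
      ENNReal.mul_top (coneLaplace_ne_zero _), eq_top_iff]
    have hlim : Filter.Tendsto (fun ε : ℝ => coneLaplace (1 : Matrix (Fin d) (Fin d) ℝ) *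
        (ENNReal.ofReal ((S + ε • (1 : Matrix (Fin d) (Fin d) ℝ)).det ^ (((d : ℝ) + 1) / 2)))⁻¹)
        (nhdsWithin 0 (Set.Ioi 0)) (nhds ⊤) := by
      have hc : Continuous fun ε : ℝ =>
          ENNReal.ofReal ((S + ε • (1 : Matrix (Fin d) (Fin d) ℝ)).det ^ (((d : ℝ) + 1) / 2)) :=
        ENNReal.continuous_ofReal.comp ((continuous_const.add
          (continuous_id.smul continuous_const)).matrix_det.rpow_const fun _ => Or.inr hexp.le)
      have h0 := (hc.tendsto 0).inv
      rw [zero_smul, add_zero, hdet, Real.zero_rpow hexp.ne', ENNReal.ofReal_zero,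
        ENNReal.inv_zero] at h0
      have h1 := ENNReal.Tendsto.const_mul (a := coneLaplace (1 : Matrix (Fin d) (Fin d) ℝ)) h0
        (Or.inl ENNReal.top_ne_zero)
      rw [ENNReal.mul_top (coneLaplace_ne_zero _)] at h1
      exact h1.mono_left nhdsWithin_le_nhds
    refine le_of_tendsto hlim (eventually_nhdsWithin_of_forall fun ε hε => ?_)
    have hpd : (S + ε • (1 : Matrix (Fin d) (Fin d) ℝ)).PosDef :=
      Matrix.PosDef.posSemidef_add hS (Matrix.PosDef.one.smul hε)
    rw [← coneLaplace_posDef hpd]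
    refine covIntegral_mono fun X hX => ENNReal.ofReal_le_ofReal (Real.exp_le_exp.2 ?_)
    rw [Matrix.mul_add, Matrix.trace_add, Matrix.mul_smul, mul_one, Matrix.trace_smul,
      smul_eq_mul]
    have := mul_nonneg (le_of_lt (show (0 : ℝ) < ε from hε)) hX.posSemidef.trace_nonneg
    linarith
  · exact coneLaplace_posDef (hS.posDef_iff_det_ne_zero.2 hdet)

/-! ### Integrating out the row covariance -/

section Model

variable {n p : ℕ}

lemma posSemidef_mul_inv_mul_transpose (D : Matrix (Fin n) (Fin p) ℝ)
    {C : Matrix (Fin p) (Fin p) ℝ} (hC : C.PosDef) : (D * C⁻¹ * Dᵀ).PosSemidef := by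
  simpa [Matrix.conjTranspose_eq_transpose_of_trivial] using
    hC.inv.posSemidef.mul_mul_conjTranspose_same D

lemma det_mul_inv_mul_transpose_ne_zero_iff (D : Matrix (Fin n) (Fin p) ℝ)
    {C : Matrix (Fin p) (Fin p) ℝ} (hC : C.PosDef) :
    (D * C⁻¹ * Dᵀ).det ≠ 0 ↔ D.rank = n := by
  constructor
  · intro h
    have h1 : (D * C⁻¹ * Dᵀ).rank = n := by
      rw [Matrix.rank_of_isUnit _ ((Matrix.isUnit_iff_isUnit_det _).2 h.isUnit), Fintype.card_fin]
    have h2 : (D * C⁻¹ * Dᵀ).rank ≤ D.rank := by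
      rw [Matrix.mul_assoc]
      exact Matrix.rank_mul_le_left _ _
    exact le_antisymm (by simpa using D.rank_le_card_height) (h1.symm.le.trans h2)
  · intro h
    have hinj : Function.Injective D.vecMul := by
      rw [Matrix.vecMul_injective_iff, linearIndependent_iff_card_eq_finrank_span,
        Fintype.card_fin, Set.finrank, ← Matrix.rank_eq_finrank_span_row, h]
    have := hC.inv.mul_mul_conjTranspose_same hinj
    rw [Matrix.conjTranspose_eq_transpose_of_trivial] at this
    exact this.det_pos.ne'

/-- The constant in the likelihood of `Σ_C` after integrating out `Σ_R`. -/
noncomputable def likelihoodConstant (n p : ℕ) : ℝ≥0∞ :=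
  ENNReal.ofReal ((2 * Real.pi) ^ ((n : ℝ) * (p : ℝ) / 2))⁻¹ *
    coneLaplace (1 : Matrix (Fin n) (Fin n) ℝ)

lemma likelihoodConstant_ne_zero (n p : ℕ) : likelihoodConstant n p ≠ 0 := by
  refine mul_ne_zero (ENNReal.ofReal_pos.2 ?_).ne' (coneLaplace_ne_zero _)
  positivity

lemma likelihoodConstant_ne_top (n p : ℕ) : likelihoodConstant n p ≠ ⊤ :=
  ENNReal.mul_ne_top ENNReal.ofReal_ne_top (coneLaplace_one_ne_top n)

lemma detFactor_ne_top (D : Matrix (Fin n) (Fin p) ℝ) (C : Matrix (Fin p) (Fin p) ℝ) :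
    detFactor D C ≠ ⊤ := ENNReal.ofReal_ne_top

/-- The exponents `n/2` and `n/2 + 1` add up to `n + 1`, so `covIntegral_inv` absorbs the whole
power of `R.det`. -/
lemma matrixNormalLikelihood_mul_rowPrior (D : Matrix (Fin n) (Fin p) ℝ)
    (C : Matrix (Fin p) (Fin p) ℝ) {R : Matrix (Fin n) (Fin n) ℝ} (hR : R.PosDef) :
    matrixNormalLikelihood R C D * rowPrior R =
      ((2 * Real.pi) ^ ((n : ℝ) * (p : ℝ) / 2))⁻¹ * (C.det ^ ((p : ℝ) / 2))⁻¹ *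
        (R.det⁻¹ ^ (n + 1) * Real.exp (-(1 / 2) * (R⁻¹ * (D * C⁻¹ * Dᵀ)).trace)) := by
  have hpow : (R.det ^ ((n : ℝ) / 2))⁻¹ * R.det ^ (-(n : ℝ) / 2 - 1) = R.det⁻¹ ^ (n + 1) := by
    rw [← Real.rpow_neg hR.det_pos.le, ← Real.rpow_add hR.det_pos, inv_pow,
      ← Real.rpow_natCast, ← Real.rpow_neg hR.det_pos.le]
    congr 1
    push_cast
    ring
  rw [matrixNormalLikelihood, rowPrior, ← hpow, one_div, mul_inv, mul_inv]
  simp only [Matrix.mul_assoc]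
  ring

theorem unnormalisedLikelihood_eq (D : Matrix (Fin n) (Fin p) ℝ)
    {C : Matrix (Fin p) (Fin p) ℝ} (hC : C.PosDef) :
    unnormalisedLikelihood C D = likelihoodConstant n p * (detFactor D C)⁻¹ := by
  have hCpos : 0 < C.det ^ ((p : ℝ) / 2) := Real.rpow_pos_of_pos hC.det_pos _
  have h1 : unnormalisedLikelihood C D =
      ENNReal.ofReal ((2 * Real.pi) ^ ((n : ℝ) * (p : ℝ) / 2))⁻¹ *
        (ENNReal.ofReal (C.det ^ ((p : ℝ) / 2)))⁻¹ * coneLaplace (D * C⁻¹ * Dᵀ) := by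
    rw [coneLaplace, covIntegral_inv, ← covIntegral_const_mul, unnormalisedLikelihood]
    · refine covIntegral_congr fun R hR => ?_
      have hR0 : 0 ≤ R.det⁻¹ ^ (n + 1) := pow_nonneg (inv_nonneg.2 hR.det_pos.le) _
      rw [matrixNormalLikelihood_mul_rowPrior D C hR, ENNReal.ofReal_mul (by positivity),
        ENNReal.ofReal_mul (by positivity), ENNReal.ofReal_mul hR0,
        ENNReal.ofReal_inv_of_pos hCpos]
    · rw [← ENNReal.ofReal_inv_of_pos hCpos]
      exact ENNReal.mul_ne_top ENNReal.ofReal_ne_top ENNReal.ofReal_ne_top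
  rw [h1, coneLaplace_posSemidef (posSemidef_mul_inv_mul_transpose D hC), likelihoodConstant,
    detFactor, ENNReal.ofReal_mul hCpos.le, ENNReal.mul_inv (Or.inl (ENNReal.ofReal_pos.2 hCpos).ne')
      (Or.inl ENNReal.ofReal_ne_top)]
  ring

theorem unnormalisedLikelihood_ne_top_iff (D : Matrix (Fin n) (Fin p) ℝ)
    {C : Matrix (Fin p) (Fin p) ℝ} (hC : C.PosDef) :
    unnormalisedLikelihood C D ≠ ⊤ ↔ D.rank = n := by
  rw [unnormalisedLikelihood_eq D hC, ← det_mul_inv_mul_transpose_ne_zero_iff D hC]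
  have hCpos : 0 < C.det ^ ((p : ℝ) / 2) := Real.rpow_pos_of_pos hC.det_pos _
  have hexp : ((n : ℝ) + 1) / 2 ≠ 0 := by positivity
  have hnn := (posSemidef_mul_inv_mul_transpose D hC).det_nonneg
  have hd : detFactor D C = 0 ↔ (D * C⁻¹ * Dᵀ).det = 0 := by
    rw [detFactor, ENNReal.ofReal_eq_zero,
      (mul_nonneg hCpos.le (Real.rpow_nonneg hnn _)).ge_iff_eq', mul_eq_zero,
      Real.rpow_eq_zero hnn hexp]
    simp [hCpos.ne']
  constructor
  · intro h h0
    rw [hd.2 h0, ENNReal.inv_zero, ENNReal.mul_top (likelihoodConstant_ne_zero n p)] at h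
    exact h rfl
  · intro h
    exact ENNReal.mul_ne_top (likelihoodConstant_ne_top n p)
      (ENNReal.inv_ne_top.2 fun h0 => h (hd.1 h0))

/-! ### Normalisation and Bayes' rule -/

lemma measurable_detFactor {T : Type*} [TopologicalSpace T] [MeasurableSpace T] [BorelSpace T]
    {D : T → Matrix (Fin n) (Fin p) ℝ} {C : T → Matrix (Fin p) (Fin p) ℝ}
    (hD : Continuous D) (hC : Continuous C) : Measurable fun t => detFactor (D t) (C t) := by
  -- The adjugate is continuous everywhere, which leaves only a scalar inverse; no invertibility of
  -- `C t` is needed.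
  have hdet : ∀ t, (D t * (C t)⁻¹ * (D t)ᵀ).det =
      ((C t).det)⁻¹ ^ n * (D t * (C t).adjugate * (D t)ᵀ).det := by
    intro t
    rw [Matrix.inv_def, Ring.inverse_eq_inv', Matrix.mul_smul, Matrix.smul_mul, Matrix.det_smul,
      Fintype.card_fin]
  simp only [detFactor, hdet]
  refine ((hC.matrix_det.measurable.pow_const _).mul
    ((((hC.matrix_det.measurable.inv).pow_const n).mul ?_).pow_const _)).ennreal_ofReal
  exact (((hD.matrix_mul hC.matrix_adjugate).matrix_mul
    hD.matrix_transpose).matrix_det).measurable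

lemma continuous_dataMatrix :
    Continuous (dataMatrix : (Fin n → Fin p → ℝ) → Matrix (Fin n) (Fin p) ℝ) :=
  continuous_id

variable {ν : Measure (Fin n → Fin p → ℝ)}

lemma normaliser_eq (ν : Measure (Fin n → Fin p → ℝ)) {C : Matrix (Fin p) (Fin p) ℝ}
    (hC : C.PosDef) :
    normaliser ν C = ∫⁻ x, likelihoodConstant n p * (detFactor (dataMatrix x) C)⁻¹ ∂ν :=
  lintegral_congr fun x => unnormalisedLikelihood_eq (dataMatrix x) hC

/-- Since `detFactor` is never `⊤`, its inverse never vanishes, and a nowhere zero integrand has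
zero integral only for `ν = 0`. -/
lemma normaliser_ne_zero (hν : ν ≠ 0) {C : Matrix (Fin p) (Fin p) ℝ} (hC : C.PosDef) :
    normaliser ν C ≠ 0 := by
  have hmeas : Measurable fun x : Fin n → Fin p → ℝ =>
      likelihoodConstant n p * (detFactor (dataMatrix x) C)⁻¹ :=
    (measurable_detFactor continuous_dataMatrix continuous_const).inv.const_mul _
  rw [normaliser_eq ν hC, Ne, lintegral_eq_zero_iff hmeas]
  intro h
  refine hν (ae_eq_bot.1 (Filter.eventually_false_iff_eq_bot.1 (h.mono fun x hx => ?_)))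
  exact mul_ne_zero (likelihoodConstant_ne_zero n p)
    (ENNReal.inv_ne_zero.2 (detFactor_ne_top _ _)) hx

lemma inv_normaliser_mul_detFactor (D : Matrix (Fin n) (Fin p) ℝ)
    {C : Matrix (Fin p) (Fin p) ℝ} (h0 : normaliser ν C ≠ 0) (htop : normaliser ν C ≠ ⊤) :
    (normaliser ν C * detFactor D C)⁻¹ = (normaliser ν C)⁻¹ * (detFactor D C)⁻¹ :=
  ENNReal.mul_inv (Or.inl h0) (Or.inl htop)

lemma likelihood_eq (D : Matrix (Fin n) (Fin p) ℝ) {C : Matrix (Fin p) (Fin p) ℝ}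
    (hC : C.PosDef) (h0 : normaliser ν C ≠ 0) (htop : normaliser ν C ≠ ⊤) :
    likelihood ν C D = likelihoodConstant n p * (normaliser ν C * detFactor D C)⁻¹ := by
  rw [likelihood, unnormalisedLikelihood_eq D hC, inv_normaliser_mul_detFactor D h0 htop,
    div_eq_mul_inv]
  ring

lemma lintegral_likelihood {C : Matrix (Fin p) (Fin p) ℝ} (h0 : normaliser ν C ≠ 0)
    (htop : normaliser ν C ≠ ⊤) : ∫⁻ x, likelihood ν C (dataMatrix x) ∂ν = 1 := by
  simp only [likelihood, div_eq_mul_inv]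
  rw [lintegral_mul_const' _ _ (ENNReal.inv_ne_top.2 h0)]
  exact ENNReal.mul_inv_cancel h0 htop

lemma uniformPrior_ne_top (p : ℕ) : uniformPrior p ≠ ⊤ :=
  ENNReal.inv_ne_top.2 (volume_corrRegion_ne_zero p)

lemma uniformPrior_ne_zero (p : ℕ) : uniformPrior p ≠ 0 :=
  ENNReal.inv_ne_zero.2 (volume_corrRegion_ne_top p)

lemma covIntegral_jointKernel (D : Matrix (Fin n) (Fin p) ℝ) {C : Matrix (Fin p) (Fin p) ℝ}
    (hC : C.PosDef) (h0 : normaliser ν C ≠ 0) (htop : normaliser ν C ≠ ⊤) :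
    covIntegral (fun R => jointKernel ν D R C) =
      likelihoodConstant n p * uniformPrior p * (normaliser ν C * detFactor D C)⁻¹ := by
  have h1 : covIntegral (fun R => jointKernel ν D R C) =
      (normaliser ν C)⁻¹ * uniformPrior p * unnormalisedLikelihood C D := by
    rw [unnormalisedLikelihood, ← covIntegral_const_mul
      (ENNReal.mul_ne_top (ENNReal.inv_ne_top.2 h0) (uniformPrior_ne_top p))]
    refine covIntegral_congr fun R hR => ?_
    have hl : 0 ≤ matrixNormalLikelihood R C D := by
      have := Real.rpow_pos_of_pos hR.det_pos ((n : ℝ) / 2)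
      have := Real.rpow_pos_of_pos hC.det_pos ((p : ℝ) / 2)
      rw [matrixNormalLikelihood]
      positivity
    rw [jointKernel, ENNReal.ofReal_mul hl, div_eq_mul_inv]
    ring
  rw [h1, unnormalisedLikelihood_eq D hC, inv_normaliser_mul_detFactor D h0 htop]
  ring

lemma evidence_ne_zero [SFinite ν] (D : Matrix (Fin n) (Fin p) ℝ)
    (h0 : ∀ C : Matrix (Fin p) (Fin p) ℝ, C.PosDef → normaliser ν C ≠ 0)
    (htop : ∀ C : Matrix (Fin p) (Fin p) ℝ, C.PosDef → normaliser ν C ≠ ⊤) :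
    evidence ν D ≠ 0 := by
  have hms : MeasurableSet (corrRegion p) := (isOpen_corrRegion p).measurableSet
  -- This agrees with `normaliser` on `corrRegion p`, but its explicit integrand is jointly
  -- measurable, so `c` is measurable in `r`.
  set c : (StrictUpperIndex p → ℝ) → ℝ≥0∞ := fun r =>
    ∫⁻ x, likelihoodConstant n p * (detFactor (dataMatrix x) (corrMatrix r))⁻¹ ∂ν with hc
  have hcm : Measurable c := by
    refine Measurable.lintegral_prod_right'
      (f := fun z : (StrictUpperIndex p → ℝ) × (Fin n → Fin p → ℝ) =>
        likelihoodConstant n p * (detFactor (dataMatrix z.2) (corrMatrix z.1))⁻¹) ?_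
    exact (measurable_detFactor (continuous_dataMatrix.comp continuous_snd)
      (continuous_corrMatrix.comp continuous_fst)).inv.const_mul _
  have hcn : ∀ r ∈ corrRegion p, normaliser ν (corrMatrix r) = c r := fun r hr =>
    normaliser_eq ν hr
  set g : (StrictUpperIndex p → ℝ) → ℝ≥0∞ := fun r =>
    likelihoodConstant n p * uniformPrior p * (c r * detFactor D (corrMatrix r))⁻¹ with hg
  have hgm : Measurable g :=
    ((hcm.mul (measurable_detFactor continuous_const continuous_corrMatrix)).inv).const_mul _
  have hev : evidence ν D = ∫⁻ r in corrRegion p, g r := by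
    refine setLIntegral_congr_fun hms fun r hr => ?_
    change covIntegral (fun R => jointKernel ν D R (corrMatrix r)) = g r
    rw [hg, covIntegral_jointKernel D hr (h0 _ hr) (htop _ hr), hcn r hr]
  rw [hev, ← pos_iff_ne_zero, setLIntegral_pos_iff hgm]
  refine (pos_iff_ne_zero.2 (volume_corrRegion_ne_zero p)).trans_le (measure_mono fun r hr => ?_)
  refine ⟨?_, hr⟩
  rw [Function.mem_support, hg]
  refine mul_ne_zero (mul_ne_zero (likelihoodConstant_ne_zero n p) (uniformPrior_ne_zero p))
    (ENNReal.inv_ne_zero.2 (ENNReal.mul_ne_top ?_ (detFactor_ne_top _ _)))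
  rw [← hcn r hr]
  exact htop _ hr

lemma posterior_eq_div (D : Matrix (Fin n) (Fin p) ℝ) (hE : evidence ν D ≠ 0)
    (C : Matrix (Fin p) (Fin p) ℝ) :
    posterior ν D C = covIntegral (fun R => jointKernel ν D R C) * (evidence ν D)⁻¹ := by
  simp only [posterior, jointPosterior, div_eq_mul_inv]
  exact lintegral_mul_const' _ _ (ENNReal.inv_ne_top.2 hE)

lemma corrIntegral_posterior (D : Matrix (Fin n) (Fin p) ℝ) (hE : evidence ν D ≠ 0)
    (hE' : evidence ν D ≠ ⊤) : corrIntegral (posterior ν D) = 1 := by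
  rw [corrIntegral]
  simp only [posterior_eq_div D hE]
  rw [lintegral_mul_const' _ _ (ENNReal.inv_ne_top.2 hE)]
  exact ENNReal.mul_inv_cancel hE hE'

end Model

theorem mainTheorem2 (n p : ℕ) :
    ∃ K : ℝ≥0∞, K ≠ 0 ∧ K ≠ ⊤ ∧
      -- integrating out the inter-row covariance
      (∀ (D : Matrix (Fin n) (Fin p) ℝ) (C : Matrix (Fin p) (Fin p) ℝ), C.PosDef →
        unnormalisedLikelihood C D = K * (detFactor D C)⁻¹ ∧
        (unnormalisedLikelihood C D ≠ ⊤ ↔ D.rank = n)) ∧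
      -- any reference measure for which the likelihood can be normalised
      ∀ (ν : Measure (Fin n → Fin p → ℝ)) [SigmaFinite ν], ν ≠ 0 →
        (∀ C : Matrix (Fin p) (Fin p) ℝ, C.PosDef → normaliser ν C ≠ ⊤) →
        -- the likelihood of the inter-column covariance is a probability density of the data
        (∀ C : Matrix (Fin p) (Fin p) ℝ, C.PosDef →
          normaliser ν C ≠ 0 ∧
          ∫⁻ x, likelihood ν C (dataMatrix x) ∂ν = 1 ∧
          ∀ D : Matrix (Fin n) (Fin p) ℝ,
            likelihood ν C D = K * (normaliser ν C * detFactor D C)⁻¹ ∧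
            covIntegral (fun R => jointKernel ν D R C) =
              K * uniformPrior p * (normaliser ν C * detFactor D C)⁻¹) ∧
        -- the posterior under the uniform prior on correlation matrices
        (∀ D : Matrix (Fin n) (Fin p) ℝ, evidence ν D ≠ ⊤ →
          corrIntegral (posterior ν D) = 1 ∧
          (∃ k : ℝ≥0∞, k ≠ 0 ∧ k ≠ ⊤ ∧ ∀ r ∈ corrRegion p,
            posterior ν D (corrMatrix r) =
              k * (normaliser ν (corrMatrix r) * detFactor D (corrMatrix r))⁻¹) ∧
          (∃ k : ℝ≥0∞, k ≠ 0 ∧ k ≠ ⊤ ∧ ∀ r ∈ corrRegion p,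
            likelihood ν (corrMatrix r) D = k * posterior ν D (corrMatrix r))) := by
  have hK0 := likelihoodConstant_ne_zero n p
  have hK := likelihoodConstant_ne_top n p
  have hu0 := uniformPrior_ne_zero p
  have hu := uniformPrior_ne_top p
  refine ⟨likelihoodConstant n p, hK0, hK, fun D C hC =>
    ⟨unnormalisedLikelihood_eq D hC, unnormalisedLikelihood_ne_top_iff D hC⟩, ?_⟩
  intro ν _ hν hfin
  have h0 : ∀ C : Matrix (Fin p) (Fin p) ℝ, C.PosDef → normaliser ν C ≠ 0 :=
    fun C hC => normaliser_ne_zero hν hC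
  refine ⟨fun C hC => ⟨h0 C hC, lintegral_likelihood (h0 C hC) (hfin C hC), fun D =>
    ⟨likelihood_eq D hC (h0 C hC) (hfin C hC),
      covIntegral_jointKernel D hC (h0 C hC) (hfin C hC)⟩⟩, fun D hE => ?_⟩
  have hE0 : evidence ν D ≠ 0 := evidence_ne_zero D h0 hfin
  have hpost : ∀ r ∈ corrRegion p, posterior ν D (corrMatrix r) =
      likelihoodConstant n p * uniformPrior p * (evidence ν D)⁻¹ *
        (normaliser ν (corrMatrix r) * detFactor D (corrMatrix r))⁻¹ := by
    intro r hr
    rw [posterior_eq_div D hE0, covIntegral_jointKernel D hr (h0 _ hr) (hfin _ hr)]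
    ring
  -- The posterior is the likelihood times `uniformPrior p / evidence ν D`; the last witness is the
  -- reciprocal of this factor.
  refine ⟨corrIntegral_posterior D hE0 hE, ⟨_, ?_, ?_, hpost⟩,
    ⟨evidence ν D * (uniformPrior p)⁻¹, ?_, ?_, fun r hr => ?_⟩⟩
  · exact mul_ne_zero (mul_ne_zero hK0 hu0) (ENNReal.inv_ne_zero.2 hE)
  · exact ENNReal.mul_ne_top (ENNReal.mul_ne_top hK hu) (ENNReal.inv_ne_top.2 hE0)
  · exact mul_ne_zero hE0 (ENNReal.inv_ne_zero.2 hu)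
  · exact ENNReal.mul_ne_top hE (ENNReal.inv_ne_top.2 hu0)
  · rw [likelihood_eq D hr (h0 _ hr) (hfin _ hr), hpost r hr]
    calc likelihoodConstant n p * (normaliser ν (corrMatrix r) * detFactor D (corrMatrix r))⁻¹
        = (evidence ν D * (evidence ν D)⁻¹) * (uniformPrior p * (uniformPrior p)⁻¹) *
            (likelihoodConstant n p *
              (normaliser ν (corrMatrix r) * detFactor D (corrMatrix r))⁻¹) := by
          rw [ENNReal.mul_inv_cancel hE0 hE, ENNReal.mul_inv_cancel hu0 hu, one_mul, one_mul]
      _ = _ := by ring
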